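/- **Setting.** Alice has settings $x\in\{1,\dots,M_A\}$ and outcomes $a\in\{1,\dots,m_A\}$, Bob has settings $y\in\{1,\dots,M_B\}$ and outcomes $b\in\{1,\dots,m_B\}$, with $M_A,M_B\ge 1$. Statistics $\mathcal P=\{P(a,b|x,y)\}$ are a family of probability distributions of $(a,b)$ indexed by $(x,y)$. They are *no-signaling* if $P(a|x):=\sum_b P(a,b|x,y)$ does not depend on $y$ and $P(b|y):=\sum_a P(a,b|x,y)$ does not depend on $x$. *Macroscopic statistics.* Given settings $(x,y)$, let $(a_n,b_n)_{n\le N}$ be independent with law $P(\cdot,\cdot|x,y)$, let $I_{a|x}=\#\{n: a_n=a\}$, $J_{b|y}=\#\{n:b_n=b\}$ be the currents in the detectors, and consider the joint law of the fluctuation vectors $$\Big(\tfrac{I_{a|x}-N P(a|x)}{\sqrt N}\Big)_a,\qquad \Big(\tfrac{J_{b|y}-N P(b|y)}{\sqrt N}\Big)_b .$$ The *macroscopic limit* of $\mathcal P$ is the family $(\mu_{xy})$ of the limits in distribution of these laws, as $N\to\infty$. $\mathcal P$ is *macroscopically local* if its macroscopic limit has a local-variable model: there are a probability space $(\Lambda,\rho)$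 and Markov kernels $\kappa_x$ from $\Lambda$ to $\mathbb R^{m_A}$ and $\eta_y$ from $\Lambda$ to $\mathbb R^{m_B}$ with $\mu_{xy}=\int_\Lambda \kappa_x(\lambda)\otimes\eta_y(\lambda)\,d\rho(\lambda)$ for all $x,y$. *The set $\mathcal Q_1$.* $\mathcal P\in\mathcal Q_1$ (the first level of the NPA hierarchy) if there is a real symmetric positive semidefinite matrix $M$ with rows and columns indexed by the symbols $1$, $(a|x)$, $(b|y)$ such that, for all values of the labels, $M_{1,1}=1$, $M_{1,(a|x)}=P(a|x)$, $M_{1,(b|y)}=P(b|y)$, $M_{(a|x),(b|y)}=P(a,b|x,y)$, $M_{(a|x),(a'|x)}=\delta_{aa'}P(a|x)$, $M_{(b|y),(b'|y)}=\delta_{bb'}P(b|y)$; the entries involving two different settings of the same party are unconstrained. *The set $\mathcal Q$.* $\mathcal P\in\mathcal Q$ (quantum statistics) if there are complex Hilbert spaces $H_A,H_B$ of arbitrary dimension, a density operator $\rho$ on $H_A\otimes H_B$, POVMs $(E^x_a)_a$ on $H_A$ and $(E^y_b)_b$ on $H_B$, with $P(a,b|x,y)=\mathrm{Tr}\big(\rho\,(E_a^x\otimes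 E_b^y)\big)$ for all $a,b,x,y$. **Theorem.** 1. For all no-signaling statistics $\mathcal P$ the macroscopic limit exists and is unique, and $\mathcal P$ is macroscopically local if and only if $\mathcal P\in\mathcal Q_1$. 2. All quantum statistics are no-signaling, belong to $\mathcal Q_1$, and are macroscopically local. 3. For some numbers of settings and outcomes there are no-signaling statistics that are macroscopically local but not quantum. -/

import Mathlib

open MeasureTheory ProbabilityTheory Filter Topology
open scoped TensorProduct

namespace MacroLoc

noncomputable section

/-! ### Bipartite statistics -/

/-- The statistics `P(a,b|x,y)` of a bipartite experiment: for every pair of settings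
`x`, `y` (of which there are `MA` and `MB`) a probability distribution of the pair of outcomes
`(a, b)` (of which there are `mA` and `mB`). -/
abbrev Behavior (MA MB mA mB : ℕ) : Type :=
  Fin MA → Fin MB → PMF (Fin mA × Fin mB)

variable {MA MB mA mB : ℕ}

/-- The probability `P(a,b|x,y)` as a real number. -/
def prob (P : Behavior MA MB mA mB) (x : Fin MA) (y : Fin MB) (a : Fin mA) (b : Fin mB) : ℝ :=
  (P x y (a, b)).toReal

/-- Alice's marginal `P(a|x,y) = ∑ b, P(a,b|x,y)`. For no-signaling statistics it does not depend
on `y` and is the number `P(a|x)`. -/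
def margA (P : Behavior MA MB mA mB) (x : Fin MA) (y : Fin MB) (a : Fin mA) : ℝ :=
  ∑ b, prob P x y a b

/-- Bob's marginal `P(b|x,y) = ∑ a, P(a,b|x,y)`. For no-signaling statistics it does not depend
on `x` and is the number `P(b|y)`. -/
def margB (P : Behavior MA MB mA mB) (x : Fin MA) (y : Fin MB) (b : Fin mB) : ℝ :=
  ∑ a, prob P x y a b

/-- The no-signaling condition: the statistics of each party's outcome do not depend on the
setting of the other party. -/
def IsNoSignaling (P : Behavior MA MB mA mB) : Prop :=
  (∀ x y y' a, margA P x y a = margA P x y' a) ∧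
  (∀ x x' y b, margB P x y b = margB P x' y b)

/-! ### Local-variable models -/

/-- Families `Q x y` of probability measures on `S × T` (the joint law of Alice's outcome in `S`
and Bob's outcome in `T`, given the settings) that can be reproduced by local variables:
`Q x y = ∫ ρ(dl) P(· | x, l) ⊗ P(· | y, l)`. -/
def HasLVModel {S T : Type} [MeasurableSpace S] [MeasurableSpace T]
    (Q : Fin MA → Fin MB → ProbabilityMeasure (S × T)) : Prop :=
  ∃ (L : Type) (_ : MeasurableSpace L) (ρ : ProbabilityMeasure L)
    (κ : Fin MA → Kernel L S) (η : Fin MB → Kernel L T),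
    (∀ x, IsMarkovKernel (κ x)) ∧ (∀ y, IsMarkovKernel (η y)) ∧
    ∀ x y, (Q x y : Measure (S × T)) =
      (ρ : Measure L).bind fun l => (κ x l).prod (η y l)

/-! ### Macroscopic statistics -/

/-- The currents produced by `N` signals: `I a` is the number of signals that were detected by
Alice's detector `a`, and `J b` the number of those detected by Bob's detector `b`. -/
def currents {N : ℕ} (ω : Fin N → Fin mA × Fin mB) : (Fin mA → ℕ) × (Fin mB → ℕ) :=
  (fun a => Fintype.card {n : Fin N // (ω n).1 = a},
    fun b => Fintype.card {n : Fin N // (ω n).2 = b})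

/-- The macroscopic statistics for `N` signals: the joint law of the pair of currents
`(I, J)` when the settings are `x`, `y` and the `N` signals are independent, each distributed
according to `P(·,·|x,y)`. -/
def macroStat (P : Behavior MA MB mA mB) (x : Fin MA) (y : Fin MB) (N : ℕ) :
    ProbabilityMeasure ((Fin mA → ℕ) × (Fin mB → ℕ)) :=
  ProbabilityMeasure.map
    ⟨Measure.pi fun _ : Fin N => (P x y).toMeasure, inferInstance⟩
    (f := currents) (Measurable.of_discrete).aemeasurable

/-- Fluctuations of the currents around their averages, in units of `√N`:
`(I a - ⟨I a⟩) / √N` and `(J b - ⟨J b⟩) / √N`, where `⟨I a⟩ = N P(a|x)` and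
`⟨J b⟩ = N P(b|y)`. -/
def fluct (P : Behavior MA MB mA mB) (x : Fin MA) (y : Fin MB) (N : ℕ)
    (k : (Fin mA → ℕ) × (Fin mB → ℕ)) : (Fin mA → ℝ) × (Fin mB → ℝ) :=
  (fun a => ((k.1 a : ℝ) - N * margA P x y a) / √(N : ℝ),
    fun b => ((k.2 b : ℝ) - N * margB P x y b) / √(N : ℝ))

/-- The macroscopic statistics for `N` signals, expressed through the fluctuations. -/
def fluctStat (P : Behavior MA MB mA mB) (x : Fin MA) (y : Fin MB) (N : ℕ) :
    ProbabilityMeasure ((Fin mA → ℝ) × (Fin mB → ℝ)) :=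
  (macroStat P x y N).map (f := fluct P x y N) (Measurable.of_discrete).aemeasurable

/-- `Q` is the family of macroscopic statistics in the limit of infinitely many signals
(convergence in distribution, for every pair of settings). -/
def IsMacroLimit (P : Behavior MA MB mA mB)
    (Q : Fin MA → Fin MB → ProbabilityMeasure ((Fin mA → ℝ) × (Fin mB → ℝ))) : Prop :=
  ∀ x y, Tendsto (fun N : ℕ => fluctStat P x y N) atTop (𝓝 (Q x y))

/-- Macroscopic locality: the macroscopic statistics in the limit of infinitely many signals can
be reproduced by local variables. -/
def IsMacroLocal (P : Behavior MA MB mA mB) : Prop :=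
  ∃ Q, IsMacroLimit P Q ∧ HasLVModel Q

/-! ### The first level of the NPA hierarchy -/

/-- Labels of the operators `1`, `Π_a^x`, `Π_b^y` used at the first level of the hierarchy. -/
abbrev NPAIndex (MA MB mA mB : ℕ) : Type :=
  Unit ⊕ ((Fin MA × Fin mA) ⊕ (Fin MB × Fin mB))

/-- The label of the identity. -/
abbrev NPAIndex.one : NPAIndex MA MB mA mB := Sum.inl ()

/-- The label of `Π_a^x`. -/
abbrev NPAIndex.alice (x : Fin MA) (a : Fin mA) : NPAIndex MA MB mA mB := Sum.inr (Sum.inl (x, a))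

/-- The label of `Π_b^y`. -/
abbrev NPAIndex.bob (y : Fin MB) (b : Fin mB) : NPAIndex MA MB mA mB := Sum.inr (Sum.inr (y, b))

/-- `M` has the form of the matrix `Tr(ρ F_i† F_j)`, where the `F`'s are the identity and the
measurement operators `Π_a^x`, `Π_b^y`, and all entries that are determined by the statistics
have the value prescribed by them. Here `Π_a^x Π_{a'}^x = δ_{a a'} Π_a^x`, and likewise for Bob.
The entries that involve two different settings of one party are unconstrained. -/
structure IsMomentMatrix (P : Behavior MA MB mA mB)
    (M : Matrix (NPAIndex MA MB mA mB) (NPAIndex MA MB mA mB) ℝ) : Prop where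
  one_one : M NPAIndex.one NPAIndex.one = 1
  one_alice : ∀ x y a, M NPAIndex.one (NPAIndex.alice x a) = margA P x y a
  one_bob : ∀ x y b, M NPAIndex.one (NPAIndex.bob y b) = margB P x y b
  alice_bob : ∀ x y a b, M (NPAIndex.alice x a) (NPAIndex.bob y b) = prob P x y a b
  alice_alice : ∀ x y a a',
    M (NPAIndex.alice x a) (NPAIndex.alice x a') = if a = a' then margA P x y a else 0
  bob_bob : ∀ x y b b',
    M (NPAIndex.bob y b) (NPAIndex.bob y b') = if b = b' then margB P x y b else 0

/-- The set `𝒬₁` of the statistics that pass the first test of the hierarchy: the entries of the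
moment matrix that are not determined by the statistics can be chosen so that the matrix is
symmetric and non-negative. -/
def InQ1 (P : Behavior MA MB mA mB) : Prop :=
  ∃ M, IsMomentMatrix P M ∧ M.PosSemidef

/-! ### Quantum statistics -/

/-- The operator `T` has trace `t`: in every orthonormal basis the sum of the diagonal entries
converges (unconditionally) to `t`. -/
def HasTrace {H : Type} [NormedAddCommGroup H] [InnerProductSpace ℂ H]
    (T : H →L[ℂ] H) (t : ℂ) : Prop :=
  ∀ (ι : Type) (e : HilbertBasis ι ℂ H), HasSum (fun i => inner ℂ (e i) (T (e i))) t

/-- A quantum state: a positive operator of trace one. -/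
def IsDensityOperator {H : Type} [NormedAddCommGroup H] [InnerProductSpace ℂ H]
    (ρ : H →L[ℂ] H) : Prop :=
  ρ.IsPositive ∧ HasTrace ρ 1

/-- A POVM with `m` outcomes: positive operators that add up to the identity. -/
def IsPOVM {H : Type} [NormedAddCommGroup H] [InnerProductSpace ℂ H] {m : ℕ}
    (E : Fin m → (H →L[ℂ] H)) : Prop :=
  (∀ a, (E a).IsPositive) ∧ ∑ a, E a = 1

/-- The tensor product of two Hilbert spaces (the completion of the algebraic one). -/
abbrev HilbertTensor (HA HB : Type) [NormedAddCommGroup HA] [InnerProductSpace ℂ HA]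
    [NormedAddCommGroup HB] [InnerProductSpace ℂ HB] : Type :=
  UniformSpace.Completion (HA ⊗[ℂ] HB)

/-- The bounded operator `E ⊗ F` on the tensor product of two Hilbert spaces. -/
def tensorOp {HA HB : Type} [NormedAddCommGroup HA] [InnerProductSpace ℂ HA]
    [NormedAddCommGroup HB] [InnerProductSpace ℂ HB]
    (E : HA →L[ℂ] HA) (F : HB →L[ℂ] HB) : HilbertTensor HA HB →L[ℂ] HilbertTensor HA HB :=
  (TensorProduct.mapL E F).completion

/-- The quantum set `𝒬`: `P(a,b|x,y) = Tr(ρ (E_a^x ⊗ E_b^y))` for some state `ρ` on the tensor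
product of two Hilbert spaces of arbitrary dimension, and some POVMs. -/
def IsQuantum (P : Behavior MA MB mA mB) : Prop :=
  ∃ (HA HB : Type) (_ : NormedAddCommGroup HA) (_ : InnerProductSpace ℂ HA)
    (_ : CompleteSpace HA) (_ : NormedAddCommGroup HB) (_ : InnerProductSpace ℂ HB)
    (_ : CompleteSpace HB)
    (ρ : HilbertTensor HA HB →L[ℂ] HilbertTensor HA HB)
    (E : Fin MA → Fin mA → (HA →L[ℂ] HA)) (F : Fin MB → Fin mB → (HB →L[ℂ] HB)),
    IsDensityOperator ρ ∧ (∀ x, IsPOVM (E x)) ∧ (∀ y, IsPOVM (F y)) ∧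
    ∀ x y a b, HasTrace (ρ ∘L tensorOp (E x a) (F y b)) (prob P x y a b : ℂ)

end

end MacroLoc

/-! The fluctuations are normalized sums of independent centred vectors, so by the central limit
theorem (`tendsto_fluctStat`) the macroscopic limit for settings x, y is the centred Gaussian law
with covariance `outcomeCov P x y`. Its entries between the parties are P(a,b|x,y) - P(a|x)P(b|y).

Part 1. A local-variable model puts the fluctuations for all settings, incompatible ones included,
on one probability space (`HasLVModel.exists_functions`). Their covariance matrix is positive
semidefinite, and adding the products of the one-signal marginals turns it into a moment matrix
(`IsMacroLocal.inQ1`). Conversely, the Schur complement of the entry 1 of a moment matrix is a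
covariance matrix, and a Gaussian vector with this covariance is itself the local variable
(`InQ1.isMacroLocal`). The unconstrained entries correspond to covariances between different
settings of one party.

Part 2. A quantum state becomes a square-summable family of vectors w and the measurements become
commuting POVMs (`IsQuantum.exists_commutingModel`). Real Gram matrices of the vectors w, A w, B w,
corrected inside each measurement by `IsPOVM.posSemidef_sub_gram`, are summed over the family
(`IsCommutingModel.inQ1`).

Part 3. A Hardy-type argument forces a probability of quantum statistics to vanish
(`IsQuantum.prob_eq_zero`). It multiplies operators of different settings, which the first level
does not see; explicit Gram vectors in dimension three violate it (`hardyBehavior`). -/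

namespace MacroLoc

/-! ### Traces against a density operator -/

section Trace

variable {H : Type} [NormedAddCommGroup H] [InnerProductSpace ℂ H]

/-- Parseval's identity in a Hilbert basis. -/
lemma hasSum_sq_norm_inner {ι : Type} (e : HilbertBasis ι ℂ H) (x : H) :
    HasSum (fun i => ‖(inner ℂ x (e i) : ℂ)‖ ^ 2) (‖x‖ ^ 2) := by
  have h := e.hasSum_inner_mul_inner x x
  rw [inner_self_eq_norm_sq_to_K] at h
  have h2 := Complex.hasSum_re h
  convert! h2 using 1
  · ext i
    rw [← inner_conj_symm (e i) x, Complex.mul_conj, Complex.ofReal_re, Complex.normSq_eq_norm_sq]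
  · norm_cast

variable [CompleteSpace H]

/-- Cyclicity of the trace, `Tr(S S T) = Tr(S T S)`, for a self-adjoint Hilbert–Schmidt
operator `S` and a bounded operator `T`. -/
lemma hasSum_inner_cyclic {ι : Type} (e : HilbertBasis ι ℂ H) {S : H →L[ℂ] H}
    (hS : ∀ x y, inner ℂ (S x) y = (inner ℂ x (S y) : ℂ))
    (hsum : Summable fun i => ‖S (e i)‖ ^ 2) (T : H →L[ℂ] H) {t : ℂ}
    (ht : HasSum (fun i => (inner ℂ (e i) (S (S (T (e i)))) : ℂ)) t) :
    HasSum (fun i => (inner ℂ (S (e i)) (T (S (e i))) : ℂ)) t := by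
  set R : H →L[ℂ] H := T.adjoint with hR
  -- The double series with terms ⟨S e_i, e_j⟩⟨e_j, S T e_i⟩ is summed in both orders: over j first
  -- it gives the known trace, over i first the wanted one.
  have hrow : ∀ i, HasSum (fun j => (inner ℂ (S (e i)) (e j) : ℂ) * inner ℂ (e j) (S (T (e i))))
      (inner ℂ (e i) (S (S (T (e i))))) := fun i => by
    rw [← hS]; exact e.hasSum_inner_mul_inner _ _
  have hcol : ∀ j, HasSum (fun i => (inner ℂ (S (e i)) (e j) : ℂ) * inner ℂ (e j) (S (T (e i))))
      (inner ℂ (S (e j)) (T (S (e j)))) := fun j => by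
    have h := e.hasSum_inner_mul_inner (R (S (e j))) (S (e j))
    rw [hR, ContinuousLinearMap.adjoint_inner_left] at h
    convert! h using 1
    ext i
    rw [ContinuousLinearMap.adjoint_inner_left, hS (e i), ← hS (e j), mul_comm]
  have hs1 : Summable fun p : ι × ι => ‖(inner ℂ (S (e p.1)) (e p.2) : ℂ)‖ ^ 2 := by
    rw [summable_prod_of_nonneg (fun _ => by positivity)]
    refine ⟨fun i => (hasSum_sq_norm_inner e (S (e i))).summable, ?_⟩
    simpa only [(hasSum_sq_norm_inner e (S (e _))).tsum_eq] using hsum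
  have hs2' : Summable fun p : ι × ι => ‖(inner ℂ (R (S (e p.1))) (e p.2) : ℂ)‖ ^ 2 := by
    rw [summable_prod_of_nonneg (fun _ => by positivity)]
    refine ⟨fun i => (hasSum_sq_norm_inner e (R (S (e i)))).summable, ?_⟩
    simp only [(hasSum_sq_norm_inner e (R (S (e _)))).tsum_eq]
    refine Summable.of_nonneg_of_le (fun _ => by positivity) (fun i => ?_)
      (hsum.mul_left (‖R‖ ^ 2))
    rw [← mul_pow]
    exact pow_le_pow_left₀ (norm_nonneg _) (R.le_opNorm _) 2
  have hs2 := hs2'.prod_symm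
  have hsummable : Summable fun p : ι × ι =>
      (inner ℂ (S (e p.1)) (e p.2) : ℂ) * inner ℂ (e p.2) (S (T (e p.1))) := by
    -- Fubini needs absolute summability, which follows from |uv| ≤ |u|² + |v|² because `S` and `R ∘
    -- S` are both Hilbert–Schmidt.
    refine Summable.of_norm_bounded (hs1.add hs2) (fun p => ?_)
    have h1 : ‖(inner ℂ (e p.2) (S (T (e p.1))) : ℂ)‖ =
        ‖(inner ℂ (R (S (e p.2))) (e p.1) : ℂ)‖ := by
      rw [hR, ContinuousLinearMap.adjoint_inner_left, hS]
    rw [norm_mul, h1]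
    simp only [Prod.fst_swap, Prod.snd_swap]
    nlinarith [sq_nonneg (‖(inner ℂ (S (e p.1)) (e p.2) : ℂ)‖ -
      ‖(inner ℂ (R (S (e p.2))) (e p.1) : ℂ)‖),
      norm_nonneg (inner ℂ (S (e p.1)) (e p.2) : ℂ),
      norm_nonneg (inner ℂ (R (S (e p.2))) (e p.1) : ℂ)]
  have h1 := hsummable.hasSum.prod_fiberwise hrow
  have h2 := (hsummable.prod_symm.hasSum).prod_fiberwise hcol
  have h3 : ∑' p : ι × ι, (fun p : ι × ι =>
      (inner ℂ (S (e p.1)) (e p.2) : ℂ) * inner ℂ (e p.2) (S (T (e p.1)))) p.swap =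
      ∑' p : ι × ι, (inner ℂ (S (e p.1)) (e p.2) : ℂ) * inner ℂ (e p.2) (S (T (e p.1))) :=
    (Equiv.prodComm ι ι).tsum_eq (fun p : ι × ι =>
      (inner ℂ (S (e p.1)) (e p.2) : ℂ) * inner ℂ (e p.2) (S (T (e p.1))))
  rw [h3, h1.unique ht] at h2
  exact h2

/-- A positive operator is the square of a self-adjoint operator. -/
lemma exists_selfAdjoint_sqrt {T : H →L[ℂ] H} (hT : T.IsPositive) :
    ∃ S : H →L[ℂ] H, (∀ x y, inner ℂ (S x) y = (inner ℂ x (S y) : ℂ)) ∧ S * S = T := by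
  have h0 : 0 ≤ T := (ContinuousLinearMap.nonneg_iff_isPositive T).2 hT
  refine ⟨CFC.sqrt T, fun x y => ?_, CFC.sqrt_mul_sqrt_self T h0⟩
  have h1 := (ContinuousLinearMap.nonneg_iff_isPositive _).1 (CFC.sqrt_nonneg T)
  exact h1.1 x y

/-- Expectation values in a state are given by a square-summable family of vectors. -/
lemma IsDensityOperator.exists_vectors {ρ : H →L[ℂ] H} (hρ : IsDensityOperator ρ) :
    ∃ (ι : Type) (w : ι → H), HasSum (fun i => ‖w i‖ ^ 2) 1 ∧
      ∀ (T : H →L[ℂ] H) (t : ℂ), HasTrace (ρ ∘L T) t →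
        HasSum (fun i => (inner ℂ (w i) (T (w i)) : ℂ)) t := by
  -- With S the square root of the state, the vectors are S e_i, and Tr(S S T) = ∑ ⟨S e_i, T S e_i⟩
  -- by cyclicity.
  obtain ⟨S, hS, rfl⟩ := exists_selfAdjoint_sqrt hρ.1
  obtain ⟨u, e, -⟩ := exists_hilbertBasis ℂ H
  have h1 : HasSum (fun i => ‖S (e i)‖ ^ 2) 1 := by
    have h := Complex.hasSum_re (hρ.2 u e)
    convert! h using 1
    ext i
    rw [mul_apply_eq_comp, ← hS, inner_self_eq_norm_sq_to_K]
    norm_cast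
  exact ⟨u, fun i => S (e i), h1, fun T t hT =>
    hasSum_inner_cyclic e hS h1.summable T (hT u e)⟩

end Trace

/-! ### Tensor products of operators -/

section Tensor

variable {HA HB : Type} [NormedAddCommGroup HA] [InnerProductSpace ℂ HA]
  [NormedAddCommGroup HB] [InnerProductSpace ℂ HB]

lemma tensorOp_coe_tmul (E : HA →L[ℂ] HA) (F : HB →L[ℂ] HB) (x : HA) (y : HB) :
    tensorOp E F ((x ⊗ₜ[ℂ] y : HA ⊗[ℂ] HB) : HilbertTensor HA HB) =
      ((E x ⊗ₜ[ℂ] F y : HA ⊗[ℂ] HB) : HilbertTensor HA HB) := by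
  rw [tensorOp, ContinuousLinearMap.completion_apply_coe, TensorProduct.mapL_tmul]

/-- Bounded operators on the tensor product that agree on product vectors are equal. -/
lemma tensor_ext {S T : HilbertTensor HA HB →L[ℂ] HilbertTensor HA HB}
    (h : ∀ (x : HA) (y : HB), S ((x ⊗ₜ[ℂ] y : HA ⊗[ℂ] HB) : HilbertTensor HA HB) =
      T ((x ⊗ₜ[ℂ] y : HA ⊗[ℂ] HB) : HilbertTensor HA HB)) : S = T := by
  ext z
  induction z using UniformSpace.Completion.induction_on with
  | hp => exact isClosed_eq S.continuous T.continuous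
  | ih z =>
    induction z using TensorProduct.induction_on with
    | zero => rw [UniformSpace.Completion.coe_zero, map_zero, map_zero]
    | tmul x y => exact h x y
    | add x y hx hy => rw [UniformSpace.Completion.coe_add, map_add, map_add, hx, hy]

lemma tensorOp_mul (E E' : HA →L[ℂ] HA) (F F' : HB →L[ℂ] HB) :
    tensorOp (E * E') (F * F') = tensorOp E F * tensorOp E' F' :=
  tensor_ext fun x y => by simp [tensorOp_coe_tmul]

lemma tensorOp_one : tensorOp (1 : HA →L[ℂ] HA) (1 : HB →L[ℂ] HB) = 1 :=
  tensor_ext fun x y => by simp [tensorOp_coe_tmul]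

lemma tensorOp_sum_left {ι : Type} (s : Finset ι) (E : ι → HA →L[ℂ] HA) (F : HB →L[ℂ] HB) :
    tensorOp (∑ i ∈ s, E i) F = ∑ i ∈ s, tensorOp (E i) F :=
  tensor_ext fun x y => by
    have h := map_sum (UniformSpace.Completion.toComplL (𝕜 := ℂ) (E := HA ⊗[ℂ] HB))
      (fun i => E i x ⊗ₜ[ℂ] F y) s
    simp only [sum_apply, tensorOp_coe_tmul, TensorProduct.sum_tmul]
    exact h

lemma tensorOp_sum_right {ι : Type} (s : Finset ι) (E : HA →L[ℂ] HA) (F : ι → HB →L[ℂ] HB) :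
    tensorOp E (∑ i ∈ s, F i) = ∑ i ∈ s, tensorOp E (F i) :=
  tensor_ext fun x y => by
    have h := map_sum (UniformSpace.Completion.toComplL (𝕜 := ℂ) (E := HA ⊗[ℂ] HB))
      (fun i => E x ⊗ₜ[ℂ] F i y) s
    simp only [sum_apply, tensorOp_coe_tmul, TensorProduct.tmul_sum]
    exact h

lemma tensorOp_symmetric {E : HA →L[ℂ] HA} {F : HB →L[ℂ] HB}
    (hE : ∀ x y, inner ℂ (E x) y = (inner ℂ x (E y) : ℂ))
    (hF : ∀ x y, inner ℂ (F x) y = (inner ℂ x (F y) : ℂ)) (z z' : HilbertTensor HA HB) :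
    inner ℂ (tensorOp E F z) z' = (inner ℂ z (tensorOp E F z') : ℂ) := by
  induction z, z' using UniformSpace.Completion.induction_on₂ with
  | hp => exact isClosed_eq (by fun_prop) (by fun_prop)
  | ih z z' =>
    simp only [tensorOp, ContinuousLinearMap.completion_apply_coe,
      UniformSpace.Completion.inner_coe]
    induction z using TensorProduct.induction_on with
    | zero => simp
    | add x y hx hy => rw [map_add, inner_add_left, inner_add_left, hx, hy]
    | tmul x y =>
      induction z' using TensorProduct.induction_on with
      | zero => simp
      | add x y hx hy => rw [map_add, inner_add_right, inner_add_right, hx, hy]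
      | tmul x' y' => simp [hE, hF]

/-- If E = R² and F = S², then E ⊗ F = (R ⊗ S)² with R ⊗ S symmetric. -/
lemma tensorOp_isPositive [CompleteSpace HA] [CompleteSpace HB] {E : HA →L[ℂ] HA}
    {F : HB →L[ℂ] HB} (hE : E.IsPositive) (hF : F.IsPositive) : (tensorOp E F).IsPositive := by
  obtain ⟨R, hR, rfl⟩ := exists_selfAdjoint_sqrt hE
  obtain ⟨S, hS, rfl⟩ := exists_selfAdjoint_sqrt hF
  refine ⟨fun x y => tensorOp_symmetric (fun x y => hE.1 x y) (fun x y => hF.1 x y) x y,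
    fun x => ?_⟩
  rw [ContinuousLinearMap.reApplyInnerSelf_apply, tensorOp_mul, mul_apply_eq_comp,
    tensorOp_symmetric hR hS]
  exact inner_self_nonneg

end Tensor

/-! ### Commuting-operator models -/

section CommutingModel

variable {MA MB mA mB : ℕ}

/-- The statistics are obtained from commuting POVMs `A`, `B` on a Hilbert space and the state
given by the square-summable family of vectors `w`. -/
structure IsCommutingModel (P : Behavior MA MB mA mB) {H : Type} [NormedAddCommGroup H]
    [InnerProductSpace ℂ H] {ι : Type} (w : ι → H) (A : Fin MA → Fin mA → (H →L[ℂ] H))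
    (B : Fin MB → Fin mB → (H →L[ℂ] H)) : Prop where
  hasSum_norm : HasSum (fun i => ‖w i‖ ^ 2) 1
  povmA : ∀ x, IsPOVM (A x)
  povmB : ∀ y, IsPOVM (B y)
  comm : ∀ x y a b v, A x a (B y b v) = B y b (A x a v)
  positive : ∀ x y a b, (A x a * B y b).IsPositive
  hasSum_prob : ∀ x y a b,
    HasSum (fun i => RCLike.re (inner ℂ (w i) (A x a (B y b (w i))) : ℂ)) (prob P x y a b)

/-- The operators E ⊗ 1 and 1 ⊗ F commute and multiply to E ⊗ F; from here on the tensor structure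
and the density operator are no longer needed. -/
lemma IsQuantum.exists_commutingModel {P : Behavior MA MB mA mB} (hP : IsQuantum P) :
    ∃ (H : Type) (_ : NormedAddCommGroup H) (_ : InnerProductSpace ℂ H) (_ : CompleteSpace H)
      (ι : Type) (w : ι → H) (A : Fin MA → Fin mA → (H →L[ℂ] H))
      (B : Fin MB → Fin mB → (H →L[ℂ] H)),
      IsCommutingModel P w A B := by
  obtain ⟨HA, HB, _, _, _, _, _, _, ρ, E, F, hρ, hE, hF, hP⟩ := hP
  obtain ⟨ι, w, hw, htr⟩ := hρ.exists_vectors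
  have hAB : ∀ x y a b, tensorOp (E x a) 1 * tensorOp 1 (F y b) = tensorOp (E x a) (F y b) :=
    fun x y a b => by rw [← tensorOp_mul, mul_one, one_mul]
  have hBA : ∀ x y a b, tensorOp 1 (F y b) * tensorOp (E x a) 1 = tensorOp (E x a) (F y b) :=
    fun x y a b => by rw [← tensorOp_mul, mul_one, one_mul]
  refine ⟨HilbertTensor HA HB, inferInstance, inferInstance, inferInstance, ι, w,
    fun x a => tensorOp (E x a) 1, fun y b => tensorOp 1 (F y b), hw,
    fun x => ⟨fun a => ?_, ?_⟩, fun y => ⟨fun b => ?_, ?_⟩,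
    fun x y a b v => ?_, fun x y a b => ?_, fun x y a b => ?_⟩
  · exact tensorOp_isPositive ((hE x).1 a) ContinuousLinearMap.isPositive_one
  · rw [← tensorOp_sum_left, (hE x).2, tensorOp_one]
  · exact tensorOp_isPositive ContinuousLinearMap.isPositive_one ((hF y).1 b)
  · rw [← tensorOp_sum_right, (hF y).2, tensorOp_one]
  · rw [← mul_apply_eq_comp, ← mul_apply_eq_comp, hAB, hBA]
  · rw [hAB]
    exact tensorOp_isPositive ((hE x).1 a) ((hF y).1 b)
  · have h := Complex.hasSum_re (htr _ _ (hP x y a b))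
    rw [← hAB] at h
    exact h

end CommutingModel

/-! ### Positive semidefinite matrices -/

lemma posSemidef_fromBlocks_diagonal {m n : Type*} [Fintype m] [Fintype n]
    {A : Matrix m m ℝ} {D : Matrix n n ℝ} (hA : A.PosSemidef) (hD : D.PosSemidef) :
    (Matrix.fromBlocks A 0 0 D).PosSemidef := by
  refine Matrix.PosSemidef.of_dotProduct_mulVec_nonneg
    (Matrix.IsHermitian.fromBlocks hA.1 (by simp) hD.1) fun x => ?_
  have h1 := hA.dotProduct_mulVec_nonneg (x ∘ Sum.inl)
  have h2 := hD.dotProduct_mulVec_nonneg (x ∘ Sum.inr)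
  simp only [Matrix.fromBlocks_mulVec, dotProduct, Fintype.sum_sum_type] at *
  simpa using add_nonneg h1 h2

lemma posSemidef_of_hasSum {n ι : Type*} [Fintype n] {N : ι → Matrix n n ℝ} {M : Matrix n n ℝ}
    (hN : ∀ k, (N k).PosSemidef) (h : ∀ i j, HasSum (fun k => N k i j) (M i j)) :
    M.PosSemidef := by
  refine Matrix.PosSemidef.of_dotProduct_mulVec_nonneg ?_ fun x => ?_
  · ext i j
    have h1 := h j i
    have h2 : (fun k => N k j i) = fun k => N k i j := by
      ext k
      simpa using (hN k).1.apply i j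
    rw [h2] at h1
    simpa using h1.unique (h i j)
  · refine HasSum.nonneg (L := .unconditional ι)
      (fun k => (hN k).dotProduct_mulVec_nonneg x) ?_
    simp only [dotProduct, Matrix.mulVec]
    exact hasSum_sum fun i _ => (hasSum_sum fun j _ => (h i j).mul_right _).mul_left _

/-- The block-diagonal matrix with blocks `N x`. -/
lemma posSemidef_blocks {X A : Type*} [Fintype X] [Fintype A] [DecidableEq X]
    {N : X → Matrix A A ℝ} (hN : ∀ x, (N x).PosSemidef) :
    (Matrix.of fun p q : X × A => if p.1 = q.1 then N p.1 p.2 q.2 else 0).PosSemidef := by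
  refine Matrix.PosSemidef.of_dotProduct_mulVec_nonneg ?_ fun v => ?_
  · ext ⟨x, a⟩ ⟨y, b⟩
    by_cases h : x = y
    · subst h
      simpa using (hN x).1.apply a b
    · simp [h, Ne.symm h]
  · have h := Finset.sum_nonneg fun x (_ : x ∈ Finset.univ) =>
      (hN x).dotProduct_mulVec_nonneg fun a => v (x, a)
    convert! h using 1
    simp [dotProduct, Matrix.mulVec, Fintype.sum_prod_type]

section Povm

variable {H : Type} [NormedAddCommGroup H] [InnerProductSpace ℂ H]

/-- The real part of the inner product. -/
noncomputable def reInner (x y : H) : ℝ := RCLike.re (inner ℂ x y : ℂ)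

/-- This is a Gram matrix in the underlying real Hilbert space. Passing to real parts provides the
real moment matrix that `InQ1` asks for. -/
lemma posSemidef_reInner {n : Type*} [Finite n] (v : n → H) :
    (Matrix.of fun i j => reInner (v i) (v j)).PosSemidef := by
  let _ : InnerProductSpace ℝ H := InnerProductSpace.rclikeToReal ℂ H
  exact Matrix.posSemidef_gram ℝ v

/-- For a POVM `E`, the difference of `⟨w, E_a w⟩ δ_{a a'}` and the Gram matrix of the vectors
`E_a w` is positive semidefinite. -/
lemma IsPOVM.posSemidef_sub_gram {m : ℕ} {E : Fin m → (H →L[ℂ] H)} (hE : IsPOVM E) (w : H) :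
    (Matrix.of fun a a' => (if a = a' then reInner w (E a w) else 0) -
      reInner (E a w) (E a' w)).PosSemidef := by
  let _ : InnerProductSpace ℝ H := InnerProductSpace.rclikeToReal ℂ H
  have hre : ∀ x y : H, reInner x y = inner ℝ x y := fun _ _ => rfl
  have hsym : ∀ c (x y : H), (inner ℝ (E c x) y : ℝ) = inner ℝ x (E c y) := fun c x y =>
    congrArg Complex.re ((hE.1 c).1 x y)
  have hpos : ∀ c (x : H), (0 : ℝ) ≤ inner ℝ x (E c x) := fun c x => by
    rw [← hsym]; exact (hE.1 c).2 x
  have hsmul : ∀ c (r : ℝ) (x : H), E c (r • x) = r • E c x := fun c r x =>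
    (E c).map_smul (r : ℂ) x
  have hone : ∀ x, ∑ c, E c x = x := fun x => by
    rw [← sum_apply, hE.2]; rfl
  simp only [hre]
  refine Matrix.PosSemidef.of_dotProduct_mulVec_nonneg ?_ fun v => ?_
  · ext a b
    simp only [Matrix.conjTranspose_apply, Matrix.of_apply, star_trivial]
    rw [real_inner_comm (E a w) (E b w)]
    by_cases h : a = b
    · subst h
      rfl
    · rw [if_neg h, if_neg (Ne.symm h)]
  -- The quadratic form at v equals ∑_c ⟨v_c w - s, E_c (v_c w - s)⟩: since ∑ E_c = 1, the cross
  -- terms give -2⟨s, s⟩ and the last ones +⟨s, s⟩.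
  · set s : H := ∑ a, v a • E a w with hs
    have hsum := Finset.sum_nonneg fun c (_ : c ∈ Finset.univ) => hpos c (v c • w - s)
    have hexp : ∀ c, (inner ℝ (v c • w - s) (E c (v c • w - s)) : ℝ) =
        v c * (v c * inner ℝ w (E c w)) - 2 * inner ℝ (v c • E c w) s + inner ℝ s (E c s) := by
      intro c
      rw [map_sub, hsmul, inner_sub_left, inner_sub_right, inner_sub_right, real_inner_smul_left,
        real_inner_smul_left, real_inner_smul_right, real_inner_smul_right, real_inner_smul_left,
        ← hsym c s w, real_inner_comm w (E c s), hsym c w s]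
      ring
    simp only [hexp, Finset.sum_add_distrib, Finset.sum_sub_distrib, ← Finset.mul_sum, ← sum_inner,
      ← inner_sum, hone, ← hs] at hsum
    have hss : (inner ℝ s s : ℝ) = ∑ a, v a * ∑ a', inner ℝ (E a w) (E a' w) * v a' := by
      conv_lhs => rw [hs]
      simp only [sum_inner, inner_sum, real_inner_smul_left, real_inner_smul_right]
      refine Finset.sum_congr rfl fun a _ => ?_
      rw [Finset.mul_sum]
      refine Finset.sum_congr rfl fun b _ => ?_
      rw [real_inner_comm]
      ring
    simp only [dotProduct, Matrix.mulVec, Matrix.of_apply, sub_mul, Finset.sum_sub_distrib,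
      mul_sub, ite_mul, zero_mul, Finset.sum_ite_eq, Finset.mem_univ, if_true, star_trivial]
    rw [← hss]
    simp only [mul_comm _ (v _)]
    linarith

end Povm

/-! ### Quantum statistics pass the first level of the hierarchy -/

section Quantum

variable {MA MB mA mB : ℕ} {P : Behavior MA MB mA mB} {H : Type} [NormedAddCommGroup H]
  [InnerProductSpace ℂ H] {ι : Type} {w : ι → H} {A : Fin MA → Fin mA → (H →L[ℂ] H)}
  {B : Fin MB → Fin mB → (H →L[ℂ] H)}

lemma IsPOVM.sum_apply_eq {m : ℕ} {E : Fin m → (H →L[ℂ] H)} (hE : IsPOVM E) (x : H) :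
    ∑ a, E a x = x := by
  rw [← sum_apply, hE.2]; rfl

lemma IsPOVM.reInner_apply {m : ℕ} {E : Fin m → (H →L[ℂ] H)} (hE : IsPOVM E) (a : Fin m)
    (x y : H) : reInner (E a x) y = reInner x (E a y) :=
  congrArg Complex.re ((hE.1 a).1 x y)

lemma reInner_sum {m : ℕ} (x : H) (y : Fin m → H) : ∑ i, reInner x (y i) = reInner x (∑ i, y i) := by
  simp only [reInner, inner_sum, map_sum]

/-- Summing over Bob's outcomes removes his POVM, and the remaining series does not involve `y`;
this is the source of no-signaling. -/
lemma IsCommutingModel.hasSum_margA (h : IsCommutingModel P w A B) (x : Fin MA) (y : Fin MB)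
    (a : Fin mA) : HasSum (fun i => reInner (w i) (A x a (w i))) (margA P x y a) := by
  have h1 := hasSum_sum fun b (_ : b ∈ Finset.univ) => h.hasSum_prob x y a b
  convert! h1 using 1
  ext i
  rw [show (∑ b, RCLike.re (inner ℂ (w i) (A x a (B y b (w i))) : ℂ)) = _ from reInner_sum _ _,
    ← map_sum, (h.povmB y).sum_apply_eq]

lemma IsCommutingModel.hasSum_margB (h : IsCommutingModel P w A B) (x : Fin MA) (y : Fin MB)
    (b : Fin mB) : HasSum (fun i => reInner (w i) (B y b (w i))) (margB P x y b) := by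
  have h1 := hasSum_sum fun a (_ : a ∈ Finset.univ) => h.hasSum_prob x y a b
  convert! h1 using 1
  ext i
  rw [show (∑ a, RCLike.re (inner ℂ (w i) (A x a (B y b (w i))) : ℂ)) = _ from reInner_sum _ _,
    (h.povmA x).sum_apply_eq]

lemma IsCommutingModel.isNoSignaling (h : IsCommutingModel P w A B) : IsNoSignaling P :=
  ⟨fun x y y' a => (h.hasSum_margA x y a).unique (h.hasSum_margA x y' a),
    fun x x' y b => (h.hasSum_margB x y b).unique (h.hasSum_margB x' y b)⟩

/-- The operators `1`, `A x a`, `B y b` that label the rows of the moment matrix. -/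
noncomputable def momentOp (A : Fin MA → Fin mA → (H →L[ℂ] H)) (B : Fin MB → Fin mB → (H →L[ℂ] H)) :
    NPAIndex MA MB mA mB → (H →L[ℂ] H) :=
  Sum.elim (fun _ => 1) (Sum.elim (fun p => A p.1 p.2) fun p => B p.1 p.2)

/-- The correction of the Gram matrix inside the blocks of a single measurement, which vanishes for
projective measurements. -/
noncomputable def momentDefect {M m : ℕ} (E : Fin M → Fin m → (H →L[ℂ] H)) (v : H) :
    Matrix (Fin M × Fin m) (Fin M × Fin m) ℝ :=
  .of fun p q => if p.1 = q.1 then (Matrix.of fun a a' => (if a = a' then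
    reInner v (E p.1 a v) else 0) - reInner (E p.1 a v) (E p.1 a' v)) p.2 q.2 else 0

/-- The moment matrix of a single vector. -/
noncomputable def vectorMoment (A : Fin MA → Fin mA → (H →L[ℂ] H))
    (B : Fin MB → Fin mB → (H →L[ℂ] H)) (v : H) :
    Matrix (NPAIndex MA MB mA mB) (NPAIndex MA MB mA mB) ℝ :=
  Matrix.of (fun i j => reInner (momentOp A B i v) (momentOp A B j v)) +
    Matrix.fromBlocks 0 0 0 (Matrix.fromBlocks (momentDefect A v) 0 0 (momentDefect B v))

lemma posSemidef_vectorMoment (hA : ∀ x, IsPOVM (A x)) (hB : ∀ y, IsPOVM (B y)) (v : H) :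
    (vectorMoment A B v).PosSemidef :=
  (posSemidef_reInner _).add <| posSemidef_fromBlocks_diagonal .zero <|
    posSemidef_fromBlocks_diagonal (posSemidef_blocks fun x => (hA x).posSemidef_sub_gram v)
      (posSemidef_blocks fun y => (hB y).posSemidef_sub_gram v)

lemma summable_reInner (hw : Summable fun i => ‖w i‖ ^ 2) (S T : H →L[ℂ] H) :
    Summable fun i => reInner (S (w i)) (T (w i)) := by
  refine Summable.of_norm_bounded (hw.mul_left (‖S‖ * ‖T‖)) fun i => ?_
  calc ‖reInner (S (w i)) (T (w i))‖ ≤ ‖S (w i)‖ * ‖T (w i)‖ :=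
        (RCLike.abs_re_le_norm _).trans (norm_inner_le_norm _ _)
    _ ≤ (‖S‖ * ‖w i‖) * (‖T‖ * ‖w i‖) := by gcongr <;> exact ContinuousLinearMap.le_opNorm _ _
    _ = _ := by ring

lemma summable_momentDefect (hw : Summable fun i => ‖w i‖ ^ 2) {M m : ℕ}
    (E : Fin M → Fin m → (H →L[ℂ] H)) (p q : Fin M × Fin m) :
    Summable fun i => momentDefect E (w i) p q := by
  simp only [momentDefect, Matrix.of_apply]
  split_ifs
  · exact (summable_reInner hw 1 _).sub (summable_reInner hw _ _)
  · exact summable_zero.sub (summable_reInner hw _ _)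
  · exact summable_zero

lemma summable_vectorMoment (hw : Summable fun i => ‖w i‖ ^ 2) (p q : NPAIndex MA MB mA mB) :
    Summable fun i => vectorMoment A B (w i) p q := by
  simp only [vectorMoment, Matrix.add_apply, Matrix.of_apply]
  refine (summable_reInner hw _ _).add ?_
  rcases p with p | p | p <;> rcases q with q | q | q
  exacts [summable_zero, summable_zero, summable_zero, summable_zero,
    summable_momentDefect hw A p q, summable_zero, summable_zero, summable_zero,
    summable_momentDefect hw B p q]

/-- Between different parties, and in the row of the identity, the Gram part already sums to the
prescribed entries. Inside one measurement `momentDefect` replaces ⟨A_a w, A_a' w⟩ by δ_{aa'} ⟨w,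
A_a w⟩, so no dilation to projections is needed. -/
lemma IsCommutingModel.inQ1 (h : IsCommutingModel P w A B) : InQ1 P := by
  have hw := h.hasSum_norm.summable
  have hM : ∀ p q, HasSum (fun i => vectorMoment A B (w i) p q)
      ((Matrix.of fun p q => ∑' i, vectorMoment A B (w i) p q) p q) :=
    fun p q => (summable_vectorMoment hw p q).hasSum
  refine ⟨_, ⟨?_, fun x y a => ?_, fun x y b => ?_, fun x y a b => ?_, fun x y a a' => ?_,
    fun x y b b' => ?_⟩, posSemidef_of_hasSum (fun i => posSemidef_vectorMoment h.povmA h.povmB _)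
      hM⟩
  · refine (hM _ _).unique ?_
    convert! h.hasSum_norm using 1
    ext i
    simp [vectorMoment, momentOp, reInner, inner_self_eq_norm_sq_to_K]
    norm_cast
  · refine (hM _ _).unique ?_
    convert! h.hasSum_margA x y a using 1
    ext i
    simp [vectorMoment, momentOp]
  · refine (hM _ _).unique ?_
    convert! h.hasSum_margB x y b using 1
    ext i
    simp [vectorMoment, momentOp]
  · refine (hM _ _).unique ?_
    convert! h.hasSum_prob x y a b using 1
    ext i
    have h1 := (h.povmA x).reInner_apply a (w i) (B y b (w i))
    simp only [vectorMoment, momentOp, Matrix.add_apply, Matrix.of_apply, Sum.elim_inr,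
      Sum.elim_inl, Matrix.fromBlocks_apply₂₂, Matrix.fromBlocks_apply₁₂, Matrix.zero_apply,
      add_zero]
    exact h1
  · refine (hM _ _).unique ?_
    by_cases haa : a = a'
    · subst haa
      simp only [if_true]
      convert! h.hasSum_margA x y a using 1
      ext i
      simp [vectorMoment, momentOp, momentDefect]
    · simp [vectorMoment, momentOp, momentDefect, haa, hasSum_zero]
  · refine (hM _ _).unique ?_
    by_cases hbb : b = b'
    · subst hbb
      simp only [if_true]
      convert! h.hasSum_margB x y b using 1
      ext i
      simp [vectorMoment, momentOp, momentDefect]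
    · simp [vectorMoment, momentOp, momentDefect, hbb, hasSum_zero]

end Quantum

/-! ### Statistics in `𝒬₁` that are not quantum -/

section Hardy

/-- A vector with vanishing expectation value of a positive operator is in its kernel. -/
lemma apply_eq_zero_of_reInner {H : Type} [NormedAddCommGroup H] [InnerProductSpace ℂ H]
    [CompleteSpace H] {T : H →L[ℂ] H} (hT : T.IsPositive) {w : H} (h : reInner w (T w) = 0) :
    T w = 0 := by
  obtain ⟨S, hS, rfl⟩ := exists_selfAdjoint_sqrt hT
  rw [mul_apply_eq_comp] at h ⊢
  rw [reInner, ← hS, inner_self_eq_norm_sq] at h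
  rw [norm_eq_zero.1 (pow_eq_zero_iff two_ne_zero |>.1 h), map_zero]

lemma apply_eq_zero_of_hasSum {H : Type} [NormedAddCommGroup H] [InnerProductSpace ℂ H]
    [CompleteSpace H] {ι : Type} {w : ι → H} {T : H →L[ℂ] H} (hT : T.IsPositive)
    (h : HasSum (fun i => reInner (w i) (T (w i))) 0) (i : ι) : T (w i) = 0 :=
  apply_eq_zero_of_reInner hT <|
    congrFun ((hasSum_zero_iff_of_nonneg fun i => hT.re_inner_nonneg_right (w i)).1 h) i

/-- A degenerate instance of Hardy's paradox: if the outcomes of the settings `1`, `1` are perfectly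
anticorrelated and `P(0,1|0,1) = P(1,0|1,0) = 0`, then `P(0,0|0,0) = 0` for quantum statistics. -/
lemma IsQuantum.prob_eq_zero {P : Behavior 2 2 2 2} (hP : IsQuantum P)
    (h00 : prob P 1 1 0 0 = 0) (h11 : prob P 1 1 1 1 = 0) (h01 : prob P 0 1 0 1 = 0)
    (h10 : prob P 1 0 1 0 = 0) : prob P 0 0 0 0 = 0 := by
  obtain ⟨H, _, _, _, ι, w, A, B, h⟩ := hP.exists_commutingModel
  have hker : ∀ x y a b, prob P x y a b = 0 → ∀ i, A x a (B y b (w i)) = 0 :=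
    fun x y a b hp i => apply_eq_zero_of_hasSum (h.positive x y a b)
      (hp ▸ h.hasSum_prob x y a b) i
  have hA : ∀ x v, A x 0 v + A x 1 v = v := fun x v => by
    simpa [Fin.sum_univ_two] using (h.povmA x).sum_apply_eq v
  have hB : ∀ y v, B y 0 v + B y 1 v = v := fun y v => by
    simpa [Fin.sum_univ_two] using (h.povmB y).sum_apply_eq v
  refine (h.hasSum_prob 0 0 0 0).unique ?_
  convert! (hasSum_zero : HasSum (fun _ : ι => (0 : ℝ)) 0) using 1
  ext i
  -- Inserting ∑ B = 1 on the left and ∑ A = 1 on the right, perfect anticorrelation makes both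
  -- sides equal to A 1 0 (B 1 1 w).
  have e1 : A 1 0 (w i) = B 1 1 (w i) := by
    have e := hB 1 (A 1 0 (w i))
    rw [← h.comm, ← h.comm, hker _ _ _ _ h00, zero_add] at e
    have e' := hA 1 (B 1 1 (w i))
    rw [hker _ _ _ _ h11, add_zero] at e'
    rw [← e, e']
  have e2 : A 0 0 (A 1 0 (w i)) = 0 := by rw [e1, hker _ _ _ _ h01]
  have e3 : B 0 0 (w i) = B 0 0 (A 1 0 (w i)) := by
    have e := hA 1 (B 0 0 (w i))
    rw [hker _ _ _ _ h10, add_zero, h.comm] at e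
    exact e.symm
  -- A 0 0 (B 0 0 w) = A 0 0 (B 0 0 (A 1 0 w)) = B 0 0 (A 0 0 (A 1 0 w)) = 0. Products such as A 0 0
  -- * A 1 0 applied to w are not among the vectors of the first level.
  rw [e3, h.comm, e2, map_zero, inner_zero_right, map_zero]

/-- Eight times the probabilities `P(a,b|x,y)` of the example. -/
def hardyTable : Fin 2 → Fin 2 → Fin 2 → Fin 2 → ℕ :=
  ![![![![1, 1], ![1, 5]], ![![2, 0], ![2, 4]]], ![![![2, 2], ![0, 4]], ![![0, 4], ![4, 0]]]]

/-- Statistics in `𝒬₁` that are not quantum. -/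
noncomputable def hardyBehavior : Behavior 2 2 2 2 := fun x y =>
  PMF.ofFintype (fun p => (hardyTable x y p.1 p.2 : ENNReal) * 8⁻¹) (by
    have h : ∀ x y, ∑ p : Fin 2 × Fin 2, hardyTable x y p.1 p.2 = 8 := by decide
    rw [← Finset.sum_mul, ← Nat.cast_sum, h]
    exact ENNReal.mul_inv_cancel (by simp) (by simp))

lemma prob_hardyBehavior (x y a b : Fin 2) :
    prob hardyBehavior x y a b = (hardyTable x y a b : ℝ) / 8 := by
  simp [prob, hardyBehavior, div_eq_mul_inv]

lemma margA_hardyBehavior (x y a : Fin 2) :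
    margA hardyBehavior x y a = ((∑ b, hardyTable x y a b : ℕ) : ℝ) / 8 := by
  simp only [margA, prob_hardyBehavior, Nat.cast_sum, Finset.sum_div]

lemma margB_hardyBehavior (x y b : Fin 2) :
    margB hardyBehavior x y b = ((∑ a, hardyTable x y a b : ℕ) : ℝ) / 8 := by
  simp only [margB, prob_hardyBehavior, Nat.cast_sum, Finset.sum_div]

lemma isNoSignaling_hardyBehavior : IsNoSignaling hardyBehavior := by
  have hA : ∀ x y y' a, ∑ b, hardyTable x y a b = ∑ b, hardyTable x y' a b := by decide
  have hB : ∀ x x' y b, ∑ a, hardyTable x y a b = ∑ a, hardyTable x' y a b := by decide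
  exact ⟨fun x y y' a => by rw [margA_hardyBehavior, margA_hardyBehavior, hA],
    fun x x' y b => by rw [margB_hardyBehavior, margB_hardyBehavior, hB]⟩

/-- Vectors whose Gram matrix is eight times a moment matrix of the example. -/
def hardyVector : NPAIndex 2 2 2 2 → Fin 3 → ℤ :=
  Sum.elim (fun _ => ![2, 2, 0]) (Sum.elim
    (fun p => (![![![0, 1, 1], ![2, 1, -1]], ![![2, 0, 0], ![0, 2, 0]]] :
      Fin 2 → Fin 2 → Fin 3 → ℤ) p.1 p.2)
    (fun p => (![![![1, 0, 1], ![1, 2, -1]], ![![0, 2, 0], ![2, 0, 0]]] :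
      Fin 2 → Fin 2 → Fin 3 → ℤ) p.1 p.2))

/-- The vectors of the settings `1` span the plane of the first two coordinates. There the zeros of
the table make the projections of `alice 0 0` and `bob 0 0` orthogonal, but their third coordinates
contribute 1, whence P(0,0|0,0) = 1/8. -/
lemma inQ1_hardyBehavior : InQ1 hardyBehavior := by
  set V : Matrix (NPAIndex 2 2 2 2) (Fin 3) ℝ := .of fun i k => (hardyVector i k : ℝ) with hV
  have hM : ∀ i j, ((8 : ℝ)⁻¹ • (V * V.conjTranspose)) i j =
      ((∑ k, hardyVector i k * hardyVector j k : ℤ) : ℝ) / 8 := fun i j => by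
    simp [hV, Matrix.mul_apply, div_eq_inv_mul]
  refine ⟨(8 : ℝ)⁻¹ • (V * V.conjTranspose), ⟨?_, ?_, ?_, ?_, ?_, ?_⟩,
    (Matrix.posSemidef_self_mul_conjTranspose V).smul (by norm_num)⟩
  · have h : ∑ k, hardyVector .one k * hardyVector .one k = 8 := by decide
    rw [hM, h]
    norm_num
  · have h : ∀ x y a, ∑ k, hardyVector .one k * hardyVector (.alice x a) k =
      ((∑ b, hardyTable x y a b : ℕ) : ℤ) := by decide
    intro x y a
    rw [hM, h x y, margA_hardyBehavior, Int.cast_natCast]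
  · have h : ∀ x y b, ∑ k, hardyVector .one k * hardyVector (.bob y b) k =
      ((∑ a, hardyTable x y a b : ℕ) : ℤ) := by decide
    intro x y b
    rw [hM, h x y, margB_hardyBehavior, Int.cast_natCast]
  · have h : ∀ x y a b, ∑ k, hardyVector (.alice x a) k * hardyVector (.bob y b) k =
      (hardyTable x y a b : ℤ) := by decide
    intro x y a b
    rw [hM, h x y, prob_hardyBehavior, Int.cast_natCast]
  · have h : ∀ x y a a', ∑ k, hardyVector (.alice x a) k * hardyVector (.alice x a') k =
      ((if a = a' then ∑ b, hardyTable x y a b else 0 : ℕ) : ℤ) := by decide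
    intro x y a a'
    rw [hM, h x y, margA_hardyBehavior, Int.cast_natCast]
    split_ifs <;> simp
  · have h : ∀ x y b b', ∑ k, hardyVector (.bob y b) k * hardyVector (.bob y b') k =
      ((if b = b' then ∑ a, hardyTable x y a b else 0 : ℕ) : ℤ) := by decide
    intro x y b b'
    rw [hM, h x y, margB_hardyBehavior, Int.cast_natCast]
    split_ifs <;> simp

lemma not_isQuantum_hardyBehavior : ¬ IsQuantum hardyBehavior := fun h => by
  have h0 := h.prob_eq_zero (by simp [prob_hardyBehavior, hardyTable])
    (by simp [prob_hardyBehavior, hardyTable]) (by simp [prob_hardyBehavior, hardyTable])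
    (by simp [prob_hardyBehavior, hardyTable])
  simp [prob_hardyBehavior, hardyTable] at h0

end Hardy

/-! ### The central limit theorem for the fluctuations -/

section CLT

/-- Rescaling reduces this to unit variance. Zero variance has to be treated apart and always occurs
in the application, since the deviations of one party add up to zero. -/
lemma tendsto_charFun_pow {Ω : Type*} [MeasurableSpace Ω] {μ : Measure Ω} [IsProbabilityMeasure μ]
    {X : Ω → ℝ} (hX : MemLp X 2 μ) (h0 : ∫ ω, X ω ∂μ = 0) :
    Tendsto (fun n : ℕ => charFun (μ.map X) ((√n)⁻¹) ^ n) atTop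
      (𝓝 (Complex.exp (-((∫ ω, X ω ^ 2 ∂μ : ℝ) : ℂ) / 2))) := by
  have hm := hX.aestronglyMeasurable.aemeasurable
  rcases eq_or_ne (∫ ω, X ω ^ 2 ∂μ) 0 with h | h
  · have hae : X =ᵐ[μ] fun _ => 0 := by
      have h1 := (integral_eq_zero_iff_of_nonneg (fun ω => sq_nonneg (X ω)) hX.integrable_sq).1 h
      filter_upwards [h1] with ω hω
      exact pow_eq_zero_iff two_ne_zero |>.1 hω
    rw [Measure.map_congr hae, h]
    simp
  · set v := ∫ ω, X ω ^ 2 ∂μ with hv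
    have hv0 : 0 ≤ v := integral_nonneg fun ω => sq_nonneg _
    have hs : √v ≠ 0 := by simpa [Real.sqrt_eq_zero hv0] using h
    -- The normalized variable X/√v is evaluated at the point √v, which undoes the rescaling.
    have h1 := tendsto_charFun_inv_sqrt_mul_pow (P := μ) (X := fun ω => (√v)⁻¹ * X ω)
      (hm.const_mul _) (by rw [integral_const_mul, h0, mul_zero]) (by
        simp only [Pi.pow_apply, mul_pow]
        rw [integral_const_mul, ← hv, inv_pow, Real.sq_sqrt hv0, inv_mul_cancel₀ h]) (√v)
    convert! h1 using 2 with n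
    · rw [charFun_map_mul_comp hm]
      congr 2
      field_simp
    · congr 2
      rw [← Complex.ofReal_pow, Real.sq_sqrt hv0]

variable {mA mB : ℕ}

/-- The identification of a pair of vectors with a vector of a Euclidean space. -/
noncomputable def toEuclidean (z : (Fin mA → ℝ) × (Fin mB → ℝ)) :
    EuclideanSpace ℝ (Fin mA ⊕ Fin mB) := WithLp.toLp 2 (Sum.elim z.1 z.2)

lemma continuous_toEuclidean : Continuous (toEuclidean (mA := mA) (mB := mB)) := by
  refine (PiLp.continuous_toLp 2 _).comp (continuous_pi fun i => ?_)
  rcases i with a | b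
  · exact (continuous_apply a).comp continuous_fst
  · exact (continuous_apply b).comp continuous_snd

/-- A pair of subvectors of a vector, with coordinates selected by `f`. -/
def selectPair {κ : Type} (f : Fin mA ⊕ Fin mB → κ) (x : EuclideanSpace ℝ κ) :
    (Fin mA → ℝ) × (Fin mB → ℝ) :=
  (fun a => x (f (.inl a)), fun b => x (f (.inr b)))

lemma continuous_selectPair {κ : Type} [Fintype κ] (f : Fin mA ⊕ Fin mB → κ) :
    Continuous (selectPair f) := by
  unfold selectPair
  fun_prop

/-- Lévy's continuity theorem for pairs of random vectors. -/
lemma tendsto_of_tendsto_integral_exp {μ : ℕ → ProbabilityMeasure ((Fin mA → ℝ) × (Fin mB → ℝ))}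
    {ν : ProbabilityMeasure ((Fin mA → ℝ) × (Fin mB → ℝ))}
    (h : ∀ t : EuclideanSpace ℝ (Fin mA ⊕ Fin mB), Tendsto
      (fun n => ∫ z, Complex.exp (inner ℝ (toEuclidean z) t * Complex.I) ∂(μ n : Measure _)) atTop
      (𝓝 (∫ z, Complex.exp (inner ℝ (toEuclidean z) t * Complex.I) ∂(ν : Measure _)))) :
    Tendsto μ atTop (𝓝 ν) := by
  -- The product type carries no inner product, so the measures are moved to a Euclidean space,
  -- where characteristic functions are available, and back by the continuous inverse `selectPair
  -- id`.
  have hc := continuous_toEuclidean (mA := mA) (mB := mB)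
  have hchar : ∀ (m : ProbabilityMeasure ((Fin mA → ℝ) × (Fin mB → ℝ)))
      (t : EuclideanSpace ℝ (Fin mA ⊕ Fin mB)),
      charFun ((m.map hc.aemeasurable : ProbabilityMeasure _) : Measure _) t =
        ∫ z, Complex.exp (inner ℝ (toEuclidean z) t * Complex.I) ∂(m : Measure _) := fun m t => by
    rw [ProbabilityMeasure.toMeasure_map, charFun_apply, integral_map hc.aemeasurable]
    exact Continuous.aestronglyMeasurable (by fun_prop)
  have h1 : Tendsto (fun n => (μ n).map hc.aemeasurable) atTop (𝓝 (ν.map hc.aemeasurable)) :=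
    ProbabilityMeasure.tendsto_iff_tendsto_charFun.2 fun t => by simpa only [hchar] using h t
  have h2 := ProbabilityMeasure.tendsto_map_of_tendsto_of_continuous _ _ h1
    (continuous_selectPair (id : Fin mA ⊕ Fin mB → _))
  have hid : ∀ m : ProbabilityMeasure ((Fin mA → ℝ) × (Fin mB → ℝ)),
      (m.map hc.aemeasurable).map
        (continuous_selectPair (id : Fin mA ⊕ Fin mB → _)).aemeasurable = m := fun m => by
    apply Subtype.ext
    change ((m : Measure ((Fin mA → ℝ) × (Fin mB → ℝ))).map toEuclidean).map
      (selectPair (id : Fin mA ⊕ Fin mB → _)) = m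
    rw [Measure.map_map (continuous_selectPair _).measurable hc.measurable]
    exact Measure.map_id
  simpa only [hid] using h2

variable {MA MB : ℕ} (P : Behavior MA MB mA mB) (x : Fin MA) (y : Fin MB)

/-- The deviation of the indicator of an outcome from its mean. -/
noncomputable def deviation (i : Fin mA ⊕ Fin mB) (p : Fin mA × Fin mB) : ℝ :=
  i.elim (fun a => (if p.1 = a then 1 else 0) - margA P x y a)
    (fun b => (if p.2 = b then 1 else 0) - margB P x y b)

/-- The covariance matrix of the indicators of the outcomes. -/
noncomputable def outcomeCov : Matrix (Fin mA ⊕ Fin mB) (Fin mA ⊕ Fin mB) ℝ :=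
  .of fun i j => ∑ p : Fin mA × Fin mB,
    prob P x y p.1 p.2 * (deviation P x y i p * deviation P x y j p)

lemma sum_prob : ∑ p : Fin mA × Fin mB, prob P x y p.1 p.2 = 1 := by
  have h := (P x y).tsum_coe
  rw [tsum_fintype] at h
  rw [← ENNReal.toReal_one, ← h, ENNReal.toReal_sum fun p _ => PMF.apply_ne_top _ p]
  rfl

lemma integral_toMeasure (f : Fin mA × Fin mB → ℝ) :
    ∫ p, f p ∂(P x y).toMeasure = ∑ p : Fin mA × Fin mB, prob P x y p.1 p.2 * f p := by
  rw [PMF.integral_eq_sum]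
  rfl

lemma sum_prob_mul_ind_left (a : Fin mA) :
    ∑ p : Fin mA × Fin mB, prob P x y p.1 p.2 * (if p.1 = a then 1 else 0) = margA P x y a := by
  simp [Fintype.sum_prod_type, margA]

lemma sum_prob_mul_ind_right (b : Fin mB) :
    ∑ p : Fin mA × Fin mB, prob P x y p.1 p.2 * (if p.2 = b then 1 else 0) = margB P x y b := by
  simp [Fintype.sum_prod_type, margB]

lemma sum_prob_mul_deviation (i : Fin mA ⊕ Fin mB) :
    ∑ p : Fin mA × Fin mB, prob P x y p.1 p.2 * deviation P x y i p = 0 := by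
  rcases i with a | b
  · simp only [deviation, Sum.elim_inl, mul_sub, Finset.sum_sub_distrib, sum_prob_mul_ind_left,
      ← Finset.sum_mul, sum_prob, one_mul, sub_self]
  · simp only [deviation, Sum.elim_inr, mul_sub, Finset.sum_sub_distrib, sum_prob_mul_ind_right,
      ← Finset.sum_mul, sum_prob, one_mul, sub_self]

lemma outcomeCov_symm (i j : Fin mA ⊕ Fin mB) : outcomeCov P x y i j = outcomeCov P x y j i := by
  simp only [outcomeCov, Matrix.of_apply, mul_comm (deviation P x y i _)]

lemma outcomeCov_inl_inl (a a' : Fin mA) : outcomeCov P x y (.inl a) (.inl a') =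
    (if a = a' then margA P x y a else 0) - margA P x y a * margA P x y a' := by
  -- The second deviation is left unexpanded in the last term, which then has mean zero.
  have h : ∀ p : Fin mA × Fin mB, prob P x y p.1 p.2 *
      (deviation P x y (.inl a) p * deviation P x y (.inl a') p) =
      (if a = a' then prob P x y p.1 p.2 * (if p.1 = a then 1 else 0) else 0) -
      margA P x y a' * (prob P x y p.1 p.2 * (if p.1 = a then 1 else 0)) -
      margA P x y a * (prob P x y p.1 p.2 * deviation P x y (.inl a') p) := fun p => by
    simp only [deviation, Sum.elim_inl]
    split_ifs <;> first | ring1 | (exfalso; simp_all)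
  simp only [outcomeCov, Matrix.of_apply, h, Finset.sum_sub_distrib, ← Finset.mul_sum,
    sum_prob_mul_ind_left, sum_prob_mul_deviation, mul_zero, sub_zero]
  split_ifs
  · rw [sum_prob_mul_ind_left, mul_comm]
  · simp [mul_comm]

lemma outcomeCov_inr_inr (b b' : Fin mB) : outcomeCov P x y (.inr b) (.inr b') =
    (if b = b' then margB P x y b else 0) - margB P x y b * margB P x y b' := by
  have h : ∀ p : Fin mA × Fin mB, prob P x y p.1 p.2 *
      (deviation P x y (.inr b) p * deviation P x y (.inr b') p) =
      (if b = b' then prob P x y p.1 p.2 * (if p.2 = b then 1 else 0) else 0) -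
      margB P x y b' * (prob P x y p.1 p.2 * (if p.2 = b then 1 else 0)) -
      margB P x y b * (prob P x y p.1 p.2 * deviation P x y (.inr b') p) := fun p => by
    simp only [deviation, Sum.elim_inr]
    split_ifs <;> first | ring1 | (exfalso; simp_all)
  simp only [outcomeCov, Matrix.of_apply, h, Finset.sum_sub_distrib, ← Finset.mul_sum,
    sum_prob_mul_ind_right, sum_prob_mul_deviation, mul_zero, sub_zero]
  split_ifs
  · rw [sum_prob_mul_ind_right, mul_comm]
  · simp [mul_comm]

lemma outcomeCov_inl_inr (a : Fin mA) (b : Fin mB) : outcomeCov P x y (.inl a) (.inr b) =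
    prob P x y a b - margA P x y a * margB P x y b := by
  have h : ∀ p : Fin mA × Fin mB, prob P x y p.1 p.2 *
      (deviation P x y (.inl a) p * deviation P x y (.inr b) p) =
      (if p.2 = b then if p.1 = a then prob P x y p.1 p.2 else 0 else 0) -
      margB P x y b * (prob P x y p.1 p.2 * (if p.1 = a then 1 else 0)) -
      margA P x y a * (prob P x y p.1 p.2 * deviation P x y (.inr b) p) := fun p => by
    simp only [deviation, Sum.elim_inl, Sum.elim_inr]
    split_ifs <;> ring
  simp only [outcomeCov, Matrix.of_apply, h, Finset.sum_sub_distrib, ← Finset.mul_sum,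
    sum_prob_mul_ind_left, sum_prob_mul_deviation, mul_zero, sub_zero]
  rw [mul_comm (margB P x y b)]
  simp [Fintype.sum_prod_type]

lemma outcomeCov_quadratic (t : Fin mA ⊕ Fin mB → ℝ) : t ⬝ᵥ (outcomeCov P x y).mulVec t =
    ∑ p : Fin mA × Fin mB, prob P x y p.1 p.2 * (∑ i, t i * deviation P x y i p) ^ 2 := by
  simp only [dotProduct, Matrix.mulVec, outcomeCov, Matrix.of_apply, sq, Finset.sum_mul_sum]
  simp only [Finset.mul_sum, Finset.sum_mul]
  refine ((Finset.sum_congr rfl fun i _ => Finset.sum_comm).trans Finset.sum_comm).trans ?_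
  refine Finset.sum_congr rfl fun p _ => Finset.sum_congr rfl fun i _ =>
    Finset.sum_congr rfl fun j _ => ?_
  ring

lemma posSemidef_outcomeCov : (outcomeCov P x y).PosSemidef := by
  refine Matrix.PosSemidef.of_dotProduct_mulVec_nonneg ?_ fun t => ?_
  · ext i j
    exact outcomeCov_symm P x y j i
  · rw [star_trivial, outcomeCov_quadratic]
    exact Finset.sum_nonneg fun p _ => mul_nonneg ENNReal.toReal_nonneg (sq_nonneg _)

lemma inner_toEuclidean_fluct {N : ℕ} (ω : Fin N → Fin mA × Fin mB)
    (t : EuclideanSpace ℝ (Fin mA ⊕ Fin mB)) :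
    inner ℝ (toEuclidean (fluct P x y N (currents ω))) t =
      ∑ n, (∑ i, t i * deviation P x y i (ω n)) * (√(N : ℝ))⁻¹ := by
  rw [← Finset.sum_mul, Finset.sum_comm]
  simp only [← Finset.mul_sum, PiLp.inner_apply, Fintype.sum_sum_type, add_mul, Finset.sum_mul]
  congr 1
  · refine Finset.sum_congr rfl fun a _ => ?_
    simp [toEuclidean, fluct, currents, deviation, Fintype.card_subtype, div_eq_mul_inv]
    ring
  · refine Finset.sum_congr rfl fun a _ => ?_
    simp [toEuclidean, fluct, currents, deviation, Fintype.card_subtype, div_eq_mul_inv]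
    ring

/-- By `inner_toEuclidean_fluct` the exponent is a sum over independent signals, so the integral
factorizes. -/
lemma integral_exp_fluctStat (N : ℕ) (t : EuclideanSpace ℝ (Fin mA ⊕ Fin mB)) :
    ∫ z, Complex.exp (inner ℝ (toEuclidean z) t * Complex.I) ∂(fluctStat P x y N : Measure _) =
      charFun ((P x y).toMeasure.map fun p => ∑ i, t i * deviation P x y i p) ((√N)⁻¹) ^ N := by
  have hc := continuous_toEuclidean (mA := mA) (mB := mB)
  have h1 : (fluctStat P x y N : Measure _) =
      (((Measure.pi fun _ : Fin N => (P x y).toMeasure)).map currents).map (fluct P x y N) := rfl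
  rw [h1, integral_map Measurable.of_discrete.aemeasurable
    (Continuous.aestronglyMeasurable (by fun_prop)),
    integral_map Measurable.of_discrete.aemeasurable
      Measurable.of_discrete.aestronglyMeasurable, charFun_apply_real,
    integral_map Measurable.of_discrete.aemeasurable
      (Continuous.aestronglyMeasurable (by fun_prop))]
  have h2 := integral_fintype_prod_eq_pow (ι := Fin N) (μ := (P x y).toMeasure)
    fun p => Complex.exp (((√(N : ℝ))⁻¹ : ℝ) * ((∑ i, t i * deviation P x y i p : ℝ) : ℂ) * Complex.I)
  rw [Fintype.card_fin] at h2
  rw [← h2]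
  congr 1
  ext ω
  rw [inner_toEuclidean_fluct, ← Complex.exp_sum, Complex.ofReal_sum, Finset.sum_mul]
  congr 1
  refine Finset.sum_congr rfl fun n _ => ?_
  rw [Complex.ofReal_mul, mul_comm ((∑ i, t i * deviation P x y i (ω n) : ℝ) : ℂ)]

lemma tendsto_integral_exp_fluctStat (t : EuclideanSpace ℝ (Fin mA ⊕ Fin mB)) :
    Tendsto (fun N : ℕ =>
      ∫ z, Complex.exp (inner ℝ (toEuclidean z) t * Complex.I) ∂(fluctStat P x y N : Measure _))
      atTop (𝓝 (Complex.exp (-((t.ofLp ⬝ᵥ (outcomeCov P x y).mulVec t : ℝ) : ℂ) / 2))) := by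
  simp only [integral_exp_fluctStat]
  rw [outcomeCov_quadratic, ← integral_toMeasure P x y
    fun p => (∑ i, t i * deviation P x y i p) ^ 2]
  refine tendsto_charFun_pow ?_ ?_
  · exact MemLp.of_discrete
  · rw [integral_toMeasure]
    simp only [Finset.mul_sum, mul_left_comm _ (t _)]
    rw [Finset.sum_comm]
    simp only [← Finset.mul_sum, sum_prob_mul_deviation, mul_zero, Finset.sum_const_zero]

/-- The law of a pair of subvectors of a Gaussian vector. -/
noncomputable def gaussianPair {κ : Type} [Fintype κ] [DecidableEq κ] (Γ : Matrix κ κ ℝ)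
    (f : Fin mA ⊕ Fin mB → κ) : ProbabilityMeasure ((Fin mA → ℝ) × (Fin mB → ℝ)) :=
  ProbabilityMeasure.map ⟨multivariateGaussian 0 Γ, inferInstance⟩
    (continuous_selectPair f).aemeasurable

lemma integral_exp_gaussianPair {κ : Type} [Fintype κ] [DecidableEq κ] {Γ : Matrix κ κ ℝ}
    (hΓ : Γ.PosSemidef) (f : Fin mA ⊕ Fin mB → κ) (t : EuclideanSpace ℝ (Fin mA ⊕ Fin mB)) :
    ∫ z, Complex.exp (inner ℝ (toEuclidean z) t * Complex.I) ∂(gaussianPair Γ f : Measure _) =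
      Complex.exp (-((t.ofLp ⬝ᵥ (Γ.submatrix f f).mulVec t : ℝ) : ℂ) / 2) := by
  have hc := continuous_toEuclidean (mA := mA) (mB := mB)
  have h1 : (gaussianPair Γ f : Measure _) = (multivariateGaussian 0 Γ).map (selectPair f) := rfl
  rw [h1, integral_map (continuous_selectPair f).aemeasurable
    (Continuous.aestronglyMeasurable (by fun_prop))]
  -- The image of t under the adjoint of the coordinate selection, so that pairing a selected
  -- subvector with t is pairing the whole vector with s.
  set s : EuclideanSpace ℝ κ := WithLp.toLp 2 (∑ i, t i • Pi.single (f i) 1) with hs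
  have h2 := charFun_multivariateGaussian (μ := 0) hΓ s
  have h3 : ∀ x : EuclideanSpace ℝ κ, inner ℝ (toEuclidean (selectPair f x)) t = inner ℝ x s :=
    fun x => by
    have e : ∀ i, toEuclidean (selectPair f x) i = x (f i) := by rintro (a | b) <;> rfl
    simp only [PiLp.inner_apply, e, hs, Finset.sum_apply, Pi.smul_apply, Pi.single_apply,
      smul_eq_mul, mul_ite, mul_one, mul_zero, RCLike.inner_apply, conj_trivial, Finset.sum_mul,
      ite_mul, zero_mul]
    rw [Finset.sum_comm]
    simp
  have h4 : s.ofLp ⬝ᵥ Γ.mulVec s = t.ofLp ⬝ᵥ (Γ.submatrix f f).mulVec t := by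
    simp only [hs, Matrix.mulVec_sum, Matrix.mulVec_smul, Matrix.mulVec_single_one, sum_dotProduct,
      smul_dotProduct, single_one_dotProduct, Finset.sum_apply, Pi.smul_apply, Matrix.col_apply,
      smul_eq_mul]
    simp only [dotProduct, Matrix.mulVec, Matrix.submatrix_apply, mul_comm (Γ _ _)]
  rw [charFun_apply, h4, inner_zero_right] at h2
  simp only [h3, h2]
  congr 1
  push_cast
  ring

/-- The central limit theorem for the fluctuations. -/
lemma tendsto_fluctStat {κ : Type} [Fintype κ] [DecidableEq κ] {Γ : Matrix κ κ ℝ}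
    (hΓ : Γ.PosSemidef) (f : Fin mA ⊕ Fin mB → κ) (h : Γ.submatrix f f = outcomeCov P x y) :
    Tendsto (fun N => fluctStat P x y N) atTop (𝓝 (gaussianPair Γ f)) :=
  tendsto_of_tendsto_integral_exp fun t => by
    rw [integral_exp_gaussianPair hΓ, h]
    exact tendsto_integral_exp_fluctStat P x y t

end CLT

variable {MA MB mA mB : ℕ}

/-! ### Macroscopic limits -/

lemma isMacroLimit_gaussianPair (P : Behavior MA MB mA mB) :
    IsMacroLimit P fun x y => gaussianPair (outcomeCov P x y) id :=
  fun x y => tendsto_fluctStat P x y (posSemidef_outcomeCov P x y) id (Matrix.submatrix_id_id _)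

lemma IsMacroLimit.unique {P : Behavior MA MB mA mB}
    {Q Q' : Fin MA → Fin MB → ProbabilityMeasure ((Fin mA → ℝ) × (Fin mB → ℝ))}
    (h : IsMacroLimit P Q) (h' : IsMacroLimit P Q') : Q = Q' :=
  funext₂ fun x y => tendsto_nhds_unique (h x y) (h' x y)

lemma existsUnique_isMacroLimit (P : Behavior MA MB mA mB) : ∃! Q, IsMacroLimit P Q :=
  ⟨_, isMacroLimit_gaussianPair P, fun _ h => h.unique (isMacroLimit_gaussianPair P)⟩

/-! ### From moment matrices to local variables -/

/-- The Schur complement of an entry `1` on the diagonal. -/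
lemma posSemidef_sub_vecMulVec {n : Type*} [Fintype n] [DecidableEq n] {M : Matrix n n ℝ}
    (hM : M.PosSemidef) {o : n} (ho : M o o = 1) :
    (Matrix.of fun i j => M i j - M o i * M o j).PosSemidef := by
  have hsymm : ∀ i j, M i j = M j i := fun i j => by simpa using hM.1.apply j i
  -- With m the row `M o`, congruence by C = 1 - e_o mᵀ gives CᵀMC = M - m mᵀ, because M e_o = m and
  -- M_oo = 1.
  convert! hM.conjTranspose_mul_mul_same (1 - Matrix.vecMulVec (Pi.single o 1) (M o)) using 1
  ext i j
  simp only [Matrix.conjTranspose_sub, Matrix.conjTranspose_one,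
    Matrix.sub_mul, Matrix.one_mul, Matrix.sub_apply, Matrix.of_apply, Matrix.mul_apply,
    Matrix.vecMulVec_apply, Matrix.conjTranspose_apply, star_trivial, Pi.single_apply]
  simp only [Matrix.one_apply, ite_mul, one_mul, zero_mul, mul_ite, mul_sub, mul_one, mul_zero,
    Finset.sum_sub_distrib, Finset.sum_ite_eq', Finset.mem_univ, if_true]
  simp [ho, hsymm i o]

/-- The local variable is a Gaussian vector indexed by all labels at once, and each party reads off
the coordinates of the chosen setting. For each x, y the relevant submatrix of `Γ` is `outcomeCov P
x y`, so these coordinates have the limit law. -/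
lemma InQ1.isMacroLocal {P : Behavior MA MB mA mB} (h : InQ1 P) : IsMacroLocal P := by
  obtain ⟨M, hM, hpos⟩ := h
  set Γ : Matrix (NPAIndex MA MB mA mB) (NPAIndex MA MB mA mB) ℝ :=
    .of fun i j => M i j - M .one i * M .one j with hΓ
  have hΓpos : Γ.PosSemidef := posSemidef_sub_vecMulVec hpos hM.one_one
  have hsymm : ∀ i j, M i j = M j i := fun i j => by simpa using hpos.1.apply j i
  set f : Fin MA → Fin MB → Fin mA ⊕ Fin mB → NPAIndex MA MB mA mB :=
    fun x y => Sum.elim (.alice x) (.bob y) with hf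
  have hsub : ∀ x y, Γ.submatrix (f x y) (f x y) = outcomeCov P x y := fun x y => by
    ext (a | b) (a' | b')
    · simp [hΓ, hf, outcomeCov_inl_inl, hM.one_alice x y, hM.alice_alice x y]
    · simp [hΓ, hf, outcomeCov_inl_inr, hM.one_alice x y, hM.one_bob x y, hM.alice_bob x y]
    · rw [outcomeCov_symm]
      simp [hΓ, hf, outcomeCov_inl_inr, hM.one_alice x y, hM.one_bob x y, hsymm (.bob y b),
        hM.alice_bob x y, mul_comm]
    · simp [hΓ, hf, outcomeCov_inr_inr, hM.one_bob x y, hM.bob_bob x y]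
  have hmA : ∀ x, Measurable fun (v : EuclideanSpace ℝ (NPAIndex MA MB mA mB)) (a : Fin mA) =>
      v (.alice x a) := fun x => by fun_prop
  have hmB : ∀ y, Measurable fun (v : EuclideanSpace ℝ (NPAIndex MA MB mA mB)) (b : Fin mB) =>
      v (.bob y b) := fun y => by fun_prop
  refine ⟨fun x y => gaussianPair Γ (f x y),
    fun x y => tendsto_fluctStat P x y hΓpos (f x y) (hsub x y),
    EuclideanSpace ℝ (NPAIndex MA MB mA mB), inferInstance,
    ⟨multivariateGaussian 0 Γ, inferInstance⟩, fun x => Kernel.deterministic _ (hmA x),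
    fun y => Kernel.deterministic _ (hmB y), fun x => inferInstance, fun y => inferInstance,
    fun x y => ?_⟩
  simp only [Kernel.deterministic_apply, Measure.dirac_prod_dirac]
  exact (Measure.bind_dirac_eq_map _ ((hmA x).prodMk (hmB y))).symm

/-! ### From local variables to moment matrices -/

section Covariance

lemma posSemidef_covariance {Ω n : Type*} [MeasurableSpace Ω] {μ : Measure Ω}
    [IsProbabilityMeasure μ] [Fintype n] {X : n → Ω → ℝ} (hX : ∀ i, MemLp (X i) 2 μ) :
    (Matrix.of fun i j => cov[X i, X j; μ]).PosSemidef := by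
  refine Matrix.PosSemidef.of_dotProduct_mulVec_nonneg ?_ fun v => ?_
  · ext i j
    exact covariance_comm _ _
  · have h := variance_nonneg (fun ω => ∑ i, v i * X i ω) μ
    rw [← covariance_self (by
      exact Finset.aemeasurable_fun_sum _ fun i _ =>
        (hX i).aestronglyMeasurable.aemeasurable.const_mul _),
      covariance_fun_sum_fun_sum (fun i => (hX i).const_mul _) (fun i => (hX i).const_mul _)] at h
    simp only [covariance_const_mul_left, covariance_const_mul_right] at h
    simp only [dotProduct, Matrix.mulVec, Matrix.of_apply, star_trivial, Finset.mul_sum]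
    refine h.trans_eq (Finset.sum_congr rfl fun i _ => Finset.sum_congr rfl fun j _ => ?_)
    ring

variable {κ : Type} [Fintype κ] [DecidableEq κ] {Γ : Matrix κ κ ℝ}

lemma continuous_toEuclidean_apply (i : Fin mA ⊕ Fin mB) :
    Continuous fun z : (Fin mA → ℝ) × (Fin mB → ℝ) => toEuclidean z i :=
  (EuclideanSpace.proj i : EuclideanSpace ℝ (Fin mA ⊕ Fin mB) →L[ℝ] ℝ).continuous.comp
    continuous_toEuclidean

lemma memLp_gaussianPair (f : Fin mA ⊕ Fin mB → κ) (i : Fin mA ⊕ Fin mB) :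
    MemLp (fun z => toEuclidean z i) 2 (gaussianPair Γ f : Measure _) := by
  refine (memLp_map_measure_iff (continuous_toEuclidean_apply _).aestronglyMeasurable
    (continuous_selectPair f).aemeasurable).2 ?_
  have h : (fun z => toEuclidean z i) ∘ selectPair f =
      (EuclideanSpace.proj (f i) : EuclideanSpace ℝ κ →L[ℝ] ℝ) := by
    ext v
    rcases i with a | b <;> rfl
  rw [h]
  exact (EuclideanSpace.proj (f i) : EuclideanSpace ℝ κ →L[ℝ] ℝ).comp_memLp'
    (IsGaussian.memLp_two_id (μ := multivariateGaussian 0 Γ))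

lemma covariance_gaussianPair (hΓ : Γ.PosSemidef) (f : Fin mA ⊕ Fin mB → κ)
    (i j : Fin mA ⊕ Fin mB) :
    cov[fun z => toEuclidean z i, fun z => toEuclidean z j; (gaussianPair Γ f : Measure _)] =
      Γ (f i) (f j) := by
  rw [← covariance_eval_multivariateGaussian (μ := 0) hΓ]
  refine (covariance_map (continuous_toEuclidean_apply _).aestronglyMeasurable
    (continuous_toEuclidean_apply _).aestronglyMeasurable
    (continuous_selectPair f).aemeasurable).trans ?_
  have h : ∀ i, (fun z => toEuclidean z i) ∘ selectPair f = fun v => v (f i) := fun i => by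
    ext v
    rcases i with a | b <;> rfl
  rw [h, h]
  rfl

end Covariance

open unitInterval in
/-- The kernels of a local-variable model can be realized by functions of independent random
variables. -/
lemma HasLVModel.exists_functions {S T : Type} [MeasurableSpace S] [MeasurableSpace T]
    [StandardBorelSpace S] [StandardBorelSpace T] [Nonempty S] [Nonempty T]
    {Q : Fin MA → Fin MB → ProbabilityMeasure (S × T)} (h : HasLVModel Q) :
    ∃ (Ω : Type) (_ : MeasurableSpace Ω) (μ : Measure Ω) (X : Fin MA → Ω → S)
      (Y : Fin MB → Ω → T), IsProbabilityMeasure μ ∧ (∀ x, Measurable (X x)) ∧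
      (∀ y, Measurable (Y y)) ∧ ∀ x y, μ.map (fun ω => (X x ω, Y y ω)) = Q x y := by
  obtain ⟨L, _, ρ, κ, η, hκ, hη, hQ⟩ := h
  -- Each kernel is the image of the uniform law on the unit interval under a function depending on
  -- l; one independent uniform variable per setting then suffices.
  choose f hf hfκ using fun x => (κ x).exists_measurable_map_eq_unitInterval
  choose g hg hgη using fun y => (η y).exists_measurable_map_eq_unitInterval
  set ν : Measure ((Fin MA → I) × (Fin MB → I)) :=
    (Measure.pi fun _ => volume).prod (Measure.pi fun _ => volume) with hν
  have hX : ∀ x, Measurable fun q : L × ((Fin MA → I) × (Fin MB → I)) => f x q.1 (q.2.1 x) :=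
    fun x => (hf x).comp (by fun_prop : Measurable
      fun q : L × ((Fin MA → I) × (Fin MB → I)) => (q.1, q.2.1 x))
  have hY : ∀ y, Measurable fun q : L × ((Fin MA → I) × (Fin MB → I)) => g y q.1 (q.2.2 y) :=
    fun y => (hg y).comp (by fun_prop : Measurable
      fun q : L × ((Fin MA → I) × (Fin MB → I)) => (q.1, q.2.2 y))
  refine ⟨L × ((Fin MA → I) × (Fin MB → I)), inferInstance, (ρ : Measure L).prod ν, _, _,
    inferInstance, hX, hY, fun x y => ?_⟩
  have hmap : ∀ l, ν.map (fun q => (f x l (q.1 x), g y l (q.2 y))) =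
      (κ x l).prod (η y l) := fun l => by
    have hfl : Measurable (f x l) := (hf x).comp measurable_prodMk_left
    have hgl : Measurable (g y l) := (hg y).comp measurable_prodMk_left
    have e1 : (Measure.pi fun _ : Fin MA => (volume : Measure I)).map (fun u => f x l (u x)) =
        κ x l := (Measure.map_map hfl (measurable_pi_apply x)).symm.trans
      (by rw [(measurePreserving_eval _ x).map_eq, hfκ])
    have e2 : (Measure.pi fun _ : Fin MB => (volume : Measure I)).map (fun u => g y l (u y)) =
        η y l := (Measure.map_map hgl (measurable_pi_apply y)).symm.trans
      (by rw [(measurePreserving_eval _ y).map_eq, hgη])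
    have m1 : Measurable fun u : Fin MA → I => f x l (u x) := hfl.comp (measurable_pi_apply x)
    have m2 : Measurable fun u : Fin MB → I => g y l (u y) := hgl.comp (measurable_pi_apply y)
    rw [← e1, ← e2, Measure.map_prod_map _ _ m1 m2]
    rfl
  rw [hQ]
  ext s hs
  rw [Measure.map_apply ((hX x).prodMk (hY y)) hs,
    Measure.prod_apply (((hX x).prodMk (hY y)) hs), Measure.bind_apply hs]
  · refine lintegral_congr fun l => ?_
    rw [← hmap, Measure.map_apply _ hs]
    · rfl
    · exact ((hX x).prodMk (hY y)).comp measurable_prodMk_left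
  · have h := (κ x ×ₖ η y).measurable.aemeasurable (μ := (ρ : Measure L))
    rwa [show ⇑(κ x ×ₖ η y) = _ from funext fun l => Kernel.prod_apply _ _ l] at h

/-- The functions `X`, `Y` on a common space have covariances even between incompatible settings,
and these fill the unconstrained entries. All others are fixed by the Gaussian limit laws. -/
lemma IsMacroLocal.inQ1 {P : Behavior MA MB mA mB} (hP : IsNoSignaling P) (x₀ : Fin MA)
    (y₀ : Fin MB) (h : IsMacroLocal P) : InQ1 P := by
  obtain ⟨Q, hQ, hLV⟩ := h
  obtain ⟨Ω, _, μ, X, Y, _, hX, hY, hXY⟩ := hLV.exists_functions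
  rw [hQ.unique (isMacroLimit_gaussianPair P)] at hXY
  set W : (Fin MA × Fin mA) ⊕ (Fin MB × Fin mB) → Ω → ℝ :=
    Sum.elim (fun p ω => X p.1 ω p.2) (fun p ω => Y p.1 ω p.2) with hW
  set f : Fin MA → Fin MB → Fin mA ⊕ Fin mB → (Fin MA × Fin mA) ⊕ (Fin MB × Fin mB) :=
    fun x y => Sum.map (Prod.mk x) (Prod.mk y) with hf
  have hm : ∀ x y, AEMeasurable (fun ω => (X x ω, Y y ω)) μ := fun x y =>
    ((hX x).prodMk (hY y)).aemeasurable
  have hcomp : ∀ x y i, (fun z => toEuclidean z i) ∘ (fun ω => (X x ω, Y y ω)) = W (f x y i) := by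
    rintro x y (a | b) <;> rfl
  have hLp : ∀ x y i, MemLp (W (f x y i)) 2 μ := fun x y i => by
    rw [← hcomp]
    refine (memLp_map_measure_iff (continuous_toEuclidean_apply _).aestronglyMeasurable (hm x y)).1 ?_
    rw [hXY]
    exact memLp_gaussianPair _ _
  have hcov : ∀ x y i j, cov[W (f x y i), W (f x y j); μ] = outcomeCov P x y i j :=
    fun x y i j => by
    rw [← hcomp, ← hcomp, ← covariance_map (continuous_toEuclidean_apply _).aestronglyMeasurable
      (continuous_toEuclidean_apply _).aestronglyMeasurable (hm x y), hXY]
    exact covariance_gaussianPair (posSemidef_outcomeCov P x y) id i j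
  -- Only joint laws of the two parties are given, so square integrability of one party's variable
  -- is read off after pairing it with a fixed setting of the other.
  have hpos := posSemidef_covariance (μ := μ) (X := W) (by
    rintro (⟨x, a⟩ | ⟨y, b⟩)
    · exact hLp x y₀ (.inl a)
    · exact hLp x₀ y (.inr b))
  set m : NPAIndex MA MB mA mB → ℝ := Sum.elim (fun _ => 1)
    (Sum.elim (fun p => margA P p.1 y₀ p.2) (fun p => margB P x₀ p.1 p.2)) with hmdef
  -- The fluctuations are centred; the rank-one term m mᵀ restores the products of marginals that
  -- were subtracted in the covariances, and supplies the row of the identity. No-signaling makes m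
  -- independent of `x₀` and `y₀`.
  have hpos2 := (posSemidef_fromBlocks_diagonal (m := Unit) .zero hpos).add
    (Matrix.posSemidef_vecMulVec_self_star m)
  refine ⟨_, ⟨?_, fun x y a => ?_, fun x y b => ?_, fun x y a b => ?_, fun x y a a' => ?_,
    fun x y b b' => ?_⟩, hpos2⟩
  · simp [Matrix.vecMulVec_apply, hmdef]
  · simp [Matrix.vecMulVec_apply, hmdef, hP.1 x y₀ y]
  · simp [Matrix.vecMulVec_apply, hmdef, hP.2 x₀ x y]
  · have h1 := hcov x y (.inl a) (.inr b)
    rw [outcomeCov_inl_inr] at h1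
    simp only [hf, Sum.map_inl, Sum.map_inr] at h1
    simp [Matrix.vecMulVec_apply, hmdef, hP.1 x y₀ y, hP.2 x₀ x y, h1]
  · have h1 := hcov x y (.inl a) (.inl a')
    rw [outcomeCov_inl_inl] at h1
    simp only [hf, Sum.map_inl] at h1
    simp [Matrix.vecMulVec_apply, hmdef, hP.1 x y₀ y, h1]
  · have h1 := hcov x y (.inr b) (.inr b')
    rw [outcomeCov_inr_inr] at h1
    simp only [hf, Sum.map_inr] at h1
    simp [Matrix.vecMulVec_apply, hmdef, hP.2 x₀ x y, h1]

end MacroLoc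

theorem mainTheorem9 :
    (∀ (MA MB mA mB : ℕ), 0 < MA → 0 < MB →
      ∀ P : MacroLoc.Behavior MA MB mA mB, MacroLoc.IsNoSignaling P →
        (∃! Q, MacroLoc.IsMacroLimit P Q) ∧
        (MacroLoc.IsMacroLocal P ↔ MacroLoc.InQ1 P)) ∧
    (∀ (MA MB mA mB : ℕ), 0 < MA → 0 < MB →
      ∀ P : MacroLoc.Behavior MA MB mA mB, MacroLoc.IsQuantum P →
        MacroLoc.IsNoSignaling P ∧ MacroLoc.InQ1 P ∧ MacroLoc.IsMacroLocal P) ∧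
    (∃ (MA MB mA mB : ℕ) (P : MacroLoc.Behavior MA MB mA mB), 0 < MA ∧ 0 < MB ∧
      MacroLoc.IsNoSignaling P ∧ MacroLoc.IsMacroLocal P ∧ ¬ MacroLoc.IsQuantum P) := by
  refine ⟨fun MA MB mA mB hA hB P hP => ⟨MacroLoc.existsUnique_isMacroLimit P,
    fun h => h.inQ1 hP ⟨0, hA⟩ ⟨0, hB⟩, fun h => h.isMacroLocal⟩,
    fun MA MB mA mB _ _ P hP => ?_, 2, 2, 2, 2, MacroLoc.hardyBehavior, by norm_num, by norm_num,
    MacroLoc.isNoSignaling_hardyBehavior, MacroLoc.inQ1_hardyBehavior.isMacroLocal,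
    MacroLoc.not_isQuantum_hardyBehavior⟩
  obtain ⟨H, _, _, _, ι, w, A, B, h⟩ := hP.exists_commutingModel
  exact ⟨h.isNoSignaling, h.inQ1, h.inQ1.isMacroLocal⟩
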